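/- Let $r\le s$, let $\mathcal M=\mathbb A^{rs}$ be the space of complex $r\times s$ matrices, and let $\mathcal M_\infty$ be its arc space, i.e. the scheme $\operatorname{Spec}\mathbb C[x_{ij}^{(n)} : 1\le i\le r,\ 1\le j\le s,\ n\ge 0]$, whose $A$-valued points (for a $\mathbb C$-algebra $A$) are the $r\times s$ matrices over $A[\![t]\!]$. The arc group $G_\infty$ of $G=GL_r\times GL_s$, whose $A$-valued points are the pairs in $GL_r(A[\![t]\!])\times GL_s(A[\![t]\!])$, acts on $\mathcal M_\infty$ by $(g,h)\cdot M=gMh^{-1}$. A pre-partition of length at most $r$ is a sequence $\lambda=(\lambda_1\ge\lambda_2\ge\dots\ge\lambda_r)$ with terms in $\mathbb N\cup\{\infty\}$, where $\mathbb N=\{0,1,2,\dots\}$. Let $\delta_\lambda\in\mathcal M_\infty$ be the $r\times s$ matrix over $\mathbb C[\![t]\!]$ whose first $s-r$ columns are zero and whose last $r$ columns form $\operatorname{diag}(t^{\lambda_1},\dots,t^{\lambda_r})$, with the convention $t^\infty=0$, and let $\mathcal C_\lambda$ be the $G_\infty$-orbit of $\delta_\lambda$. For pre-partitions $\lambda,\mu$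 of length at most $r$ write $\lambda\triangleleft\mu$ if $\lambda_i+\lambda_{i+1}+\dots+\lambda_r\le\mu_i+\mu_{i+1}+\dots+\mu_r$ for all $1\le i\le r$; this is a partial order. For $G_\infty$-orbits $\mathcal C,\mathcal C'$ in $\mathcal M_\infty$ write $\mathcal C'\le\mathcal C$ if $\mathcal C'$ is contained in the Zariski closure of $\mathcal C$. Then $\le$ is a partial order on the set of $G_\infty$-orbits of $\mathcal M_\infty$, and the map $\lambda\mapsto\mathcal C_\lambda$ is an order-reversing isomorphism from the poset of pre-partitions of length at most $r$, ordered by $\triangleleft$, onto this poset of orbits. Explicitly, every $G_\infty$-orbit is of the form $\mathcal C_\lambda$ for exactly one $\lambda$, and $$\overline{\mathcal C_\lambda}\supseteq\mathcal C_\mu\iff\lambda\triangleleft\mu\iff\lambda_{r-i}+\dots+\lambda_r\le\mu_{r-i}+\dots+\mu_r\quad\text{for all } 0\le i\le r-1.$$ This holds both when orbits are taken as sets of closed points (the orbits of matrices over $\mathbb C[\![t]\!]$ under $GL_r(\mathbb C[\![t]\!])\times GL_s(\mathbb C[\![t]\!])$) and when they are taken as sets of all points of the scheme $\mathcal M_\infty$,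 where two points lie in the same orbit if, over some field $K\supseteq\mathbb C$, they are images of $K$-valued points of $\mathcal M_\infty$ that are conjugate under $G_\infty(K)$. -/

import Mathlib

open scoped Matrix

noncomputable section

/-! ### Pre-partitions of length at most `r` -/

/-- A pre-partition of length at most `r`: a non-increasing sequence
`terms 0 ≥ terms 1 ≥ ... ≥ terms (r - 1)` in `ℕ ∪ {∞}`. -/
@[ext]
structure PrePartition (r : ℕ) where
  terms : Fin r → ℕ∞
  anti : Antitone terms

namespace PrePartition

/-- Co-domination: every tail sum of `lam` is at most the corresponding tail sum of `mu`. -/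
def CoDominated {r : ℕ} (lam mu : PrePartition r) : Prop :=
  ∀ i : Fin r, ∑ j ∈ Finset.Ici i, lam.terms j ≤ ∑ j ∈ Finset.Ici i, mu.terms j

theorem CoDominated.antisymm {r : ℕ} {lam mu : PrePartition r}
    (h₁ : CoDominated lam mu) (h₂ : CoDominated mu lam) : lam = mu := by
  have hsum : ∀ i, ∑ j ∈ Finset.Ici i, lam.terms j = ∑ j ∈ Finset.Ici i, mu.terms j :=
    fun i => le_antisymm (h₁ i) (h₂ i)
  have key : ∀ n : ℕ, ∀ i : Fin r, r - i.val = n → lam.terms i = mu.terms i := by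
    intro n
    induction n using Nat.strong_induction_on with
    | _ n ih =>
      intro i hi
      have hgt : ∀ j ∈ Finset.Ioi i, lam.terms j = mu.terms j := by
        intro j hj
        have hij : i < j := Finset.mem_Ioi.mp hj
        have hij' : i.val < j.val := hij
        have hj' := j.isLt
        exact ih (r - j.val) (by omega) j rfl
      have htail := Finset.sum_congr rfl hgt
      have h := hsum i
      rw [← Finset.Ioi_insert, Finset.sum_insert (by simp), Finset.sum_insert (by simp),
        htail] at h
      by_cases hfin : ∑ j ∈ Finset.Ioi i, mu.terms j = ⊤
      · obtain ⟨j, hj, hjt⟩ : ∃ j ∈ Finset.Ioi i, mu.terms j = ⊤ := by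
          by_contra hcon
          push Not at hcon
          exact (WithTop.sum_ne_top.mpr hcon) hfin
        have hij := (Finset.mem_Ioi.mp hj).le
        have a := lam.anti hij
        have b := mu.anti hij
        rw [hgt j hj, hjt, top_le_iff] at a
        rw [hjt, top_le_iff] at b
        rw [a, b]
      · exact (ENat.add_left_injective_of_ne_top hfin) h
  ext i
  exact key _ i rfl

/-- Pre-partitions of length at most `r`, ordered by co-domination. -/
instance (r : ℕ) : PartialOrder (PrePartition r) where
  le := CoDominated
  le_refl _ _ := le_rfl
  le_trans _ _ _ h₁ h₂ i := (h₁ i).trans (h₂ i)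
  le_antisymm _ _ := CoDominated.antisymm

end PrePartition

/-! ### The arc space of the space of `r × s` matrices -/

/-- The coordinate ring of the arc space of `𝔸^{rs}`: the variable `(i, j, n)` is the
coefficient of `t ^ n` in the `(i, j)` entry. -/
abbrev ArcRing (r s : ℕ) : Type := MvPolynomial (Fin r × Fin s × ℕ) ℂ

/-- `ArcRing r s` represents the functor `A ↦ Hom(Spec A⟦t⟧, 𝔸^{rs})` of `A`-valued arcs
of the space of matrices. -/
def arcEquiv (r s : ℕ) (A : Type*) [CommRing A] [Algebra ℂ A] :
    (ArcRing r s →ₐ[ℂ] A) ≃ Matrix (Fin r) (Fin s) (PowerSeries A) where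
  toFun φ := Matrix.of fun i j => PowerSeries.mk fun n => φ (MvPolynomial.X (i, j, n))
  invFun M := MvPolynomial.aeval fun v => PowerSeries.coeff v.2.2 (M v.1 v.2.1)
  left_inv φ := by
    apply MvPolynomial.algHom_ext
    rintro ⟨i, j, n⟩
    simp
  right_inv M := by
    ext i j n
    simp

/-- The (points of the) arc space, i.e. the prime spectrum of its coordinate ring,
with the Zariski topology. -/
abbrev ArcSpace (r s : ℕ) : Type := PrimeSpectrum (ArcRing r s)

/-- The point of the arc space underlying a `K`-valued arc, for a field `K ⊇ ℂ`:
the image of `Spec K`. For `K = ℂ` this is a closed point. -/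
def arcPoint {r s : ℕ} {K : Type*} [Field K] [Algebra ℂ K]
    (M : Matrix (Fin r) (Fin s) (PowerSeries K)) : ArcSpace r s :=
  PrimeSpectrum.comap ((arcEquiv r s K).symm M : ArcRing r s →+* K) ⊥

/-! ### Orbits of the arc group of `GL_r × GL_s` -/

/-- The orbit of a matrix over `K⟦t⟧` under `GL_r(K⟦t⟧) × GL_s(K⟦t⟧)`, the group of
`K`-valued points of the arc group, acting by `(g, h) • M = g M h⁻¹`. -/
def matrixOrbit {r s : ℕ} {K : Type*} [Field K]
    (M : Matrix (Fin r) (Fin s) (PowerSeries K)) :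
    Set (Matrix (Fin r) (Fin s) (PowerSeries K)) :=
  {N | ∃ (g : GL (Fin r) (PowerSeries K)) (h : GL (Fin s) (PowerSeries K)),
    N = (g : Matrix (Fin r) (Fin r) (PowerSeries K)) * M *
      ((h⁻¹ : GL (Fin s) (PowerSeries K)) : Matrix (Fin s) (Fin s) (PowerSeries K))}

/-- The orbit of a complex arc under the group of complex points of the arc group,
as a set of (closed) points of the arc space. -/
def closedOrbit {r s : ℕ} (M : Matrix (Fin r) (Fin s) (PowerSeries ℂ)) :
    Set (ArcSpace r s) :=
  arcPoint '' matrixOrbit M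

/-- The orbit of an arbitrary, possibly non-closed, point `p` of the arc space under the arc
group scheme: the points `q` such that, over some field `K ⊇ ℂ`, there are `K`-valued arcs at
`p` and at `q` that are conjugate under the `K`-valued points of the arc group. -/
def schemeOrbit {r s : ℕ} (p : ArcSpace r s) : Set (ArcSpace r s) :=
  {q | ∃ (K : Type) (_ : Field K) (_ : Algebra ℂ K)
    (M N : Matrix (Fin r) (Fin s) (PowerSeries K)),
    N ∈ matrixOrbit M ∧ arcPoint M = p ∧ arcPoint N = q}

/-- `t ^ a` for `a ∈ ℕ ∪ {∞}`, with `t ^ ∞ = 0`. -/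
def tPow (a : ℕ∞) : PowerSeries ℂ :=
  ENat.recTopCoe 0 (fun n => (PowerSeries.X : PowerSeries ℂ) ^ n) a

/-- The `r × s` matrix (`r ≤ s`) whose first `s - r` columns vanish and whose last `r` columns
form the diagonal matrix with entries `t ^ lam_1, ..., t ^ lam_r`. -/
def deltaMatrix {r : ℕ} (s : ℕ) (lam : PrePartition r) :
    Matrix (Fin r) (Fin s) (PowerSeries ℂ) :=
  Matrix.of fun i j => if j.val + r = i.val + s then tPow (lam.terms i) else 0

/-! ### The orbit posets

An orbit `C` dominates an orbit `D`, written `D ≤ C`, if `D` lies in the Zariski closure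
of `C`. -/

/-- The set of orbits of complex arcs, as sets of closed points of the arc space. -/
@[ext]
structure ClosedArcOrbit (r s : ℕ) where
  carrier : Set (ArcSpace r s)
  isOrbit : ∃ M, carrier = closedOrbit M

/-- The set of orbits of arbitrary scheme points of the arc space. -/
@[ext]
structure SchemeArcOrbit (r s : ℕ) where
  carrier : Set (ArcSpace r s)
  isOrbit : ∃ p, carrier = schemeOrbit p

theorem subset_closure_trans {X : Type*} [TopologicalSpace X] {A B C : Set X}
    (h₁ : A ⊆ closure B) (h₂ : B ⊆ closure C) : A ⊆ closure C :=
  h₁.trans (closure_minimal h₂ isClosed_closure)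

instance (r s : ℕ) : Preorder (ClosedArcOrbit r s) where
  le D C := D.carrier ⊆ closure C.carrier
  le_refl _ := subset_closure
  le_trans _ _ _ h₁ h₂ := subset_closure_trans h₁ h₂

instance (r s : ℕ) : Preorder (SchemeArcOrbit r s) where
  le D C := D.carrier ⊆ closure C.carrier
  le_refl _ := subset_closure
  le_trans _ _ _ h₁ h₂ := subset_closure_trans h₁ h₂

/-- The orbit associated to `lam`, as an orbit of complex arcs. -/
def closedOrbitOf {r : ℕ} (s : ℕ) (lam : PrePartition r) : ClosedArcOrbit r s :=
  ⟨closedOrbit (deltaMatrix s lam), _, rfl⟩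

/-- The orbit associated to `lam`, with its non-closed points. -/
def schemeOrbitOf {r : ℕ} (s : ℕ) (lam : PrePartition r) : SchemeArcOrbit r s :=
  ⟨schemeOrbit (arcPoint (deltaMatrix s lam)), _, rfl⟩

end

/-! ### Powers of the uniformizer -/

/-! Elimination over the discrete valuation ring `K⟦t⟧` makes every arc diagonal with sorted
exponents (`exists_unitEquivalent_diagArc`), so only the closure relations between diagonal arcs are
at stake.

Necessity comes from minors. That `t ^ a` divides all minors of a given size is invariant under row
and column operations, and it is the vanishing of polynomials in the coordinates of the arc space,
so it passes to closures (`dvdMinors_of_mem_closure`). For sorted exponents the best such `a` is a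
tail sum. Hence closure forces the tail inequalities (`le_of_arcPoint_mem_closure`), and in
particular the exponents are determined by the orbit.

Sufficiency comes from generating the order by two moves, raising one exponent or bringing two
closer with the same sum (`degeneration_of_sum_Iic_le`). Each move is realized by an affine line of
arcs whose general member is in the large orbit and whose origin is in the small one
(`DegenerationStep.subset_closure`).

Both halves work over every field containing `ℂ`. A non-closed point is an arc over its residue
field, and arcs over different fields are compared in a common extension (`exists_schemeOrbit_eq`).
-/

/-- `t ^ a` over an arbitrary field, for `a ∈ ℕ ∪ {∞}`, with `t ^ ∞ = 0`. -/
noncomputable def tPowOver (K : Type*) [Field K] (a : ℕ∞) : PowerSeries K :=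
  ENat.recTopCoe 0 (fun n => (PowerSeries.X : PowerSeries K) ^ n) a

section tPowOver

variable {K : Type*} [Field K]

@[simp] theorem tPowOver_top : tPowOver K ⊤ = 0 := rfl

@[simp] theorem tPowOver_coe (n : ℕ) : tPowOver K n = PowerSeries.X ^ n := rfl

@[simp] theorem tPowOver_zero : tPowOver K 0 = 1 := pow_zero _

theorem tPowOver_add (a b : ℕ∞) : tPowOver K (a + b) = tPowOver K a * tPowOver K b := by
  induction a using ENat.recTopCoe with
  | top => simp
  | coe a =>
    induction b using ENat.recTopCoe with
    | top => simp
    | coe b => rw [← Nat.cast_add, tPowOver_coe, pow_add]; rfl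

theorem tPowOver_sum {ι : Type*} (S : Finset ι) (f : ι → ℕ∞) :
    tPowOver K (∑ i ∈ S, f i) = ∏ i ∈ S, tPowOver K (f i) := by
  classical
  induction S using Finset.induction_on with
  | empty => simp
  | insert a S ha ih => rw [Finset.sum_insert ha, Finset.prod_insert ha, tPowOver_add, ih]

theorem tPowOver_dvd_iff {a : ℕ∞} {f : PowerSeries K} :
    tPowOver K a ∣ f ↔ ∀ n : ℕ, (n : ℕ∞) < a → PowerSeries.coeff n f = 0 := by
  induction a using ENat.recTopCoe with
  | top => rw [tPowOver_top, zero_dvd_iff]; simp only [PowerSeries.ext_iff]; simp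
  | coe a => simp [PowerSeries.X_pow_dvd_iff]

theorem tPowOver_dvd_tPowOver {a b : ℕ∞} : tPowOver K a ∣ tPowOver K b ↔ a ≤ b := by
  refine ⟨fun h => ?_, fun h => ?_⟩
  · by_contra! hab
    lift b to ℕ using hab.ne_top
    simpa using tPowOver_dvd_iff.1 h b hab
  · obtain ⟨c, rfl⟩ := exists_add_of_le h
    rw [tPowOver_add]
    exact dvd_mul_right _ _

theorem map_tPowOver {L : Type*} [Field L] (φ : K →+* L) (a : ℕ∞) :
    PowerSeries.map φ (tPowOver K a) = tPowOver L a := by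
  induction a using ENat.recTopCoe <;> simp

end tPowOver

/-! ### Equivalence of matrices -/

namespace Matrix

/-- Equivalence of rectangular matrices over a ring: `N = P M Q` with `P`, `Q` invertible. -/
def UnitEquivalent {m n R : Type*} [Fintype m] [Fintype n] [DecidableEq m] [DecidableEq n]
    [CommRing R] (M N : Matrix m n R) : Prop :=
  ∃ (P : (Matrix m m R)ˣ) (Q : (Matrix n n R)ˣ),
    N = (P : Matrix m m R) * M * (Q : Matrix n n R)

namespace UnitEquivalent

variable {m n m' n' R : Type*} [Fintype m] [Fintype n] [DecidableEq m] [DecidableEq n]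
  [Fintype m'] [Fintype n'] [DecidableEq m'] [DecidableEq n'] [CommRing R]

theorem of_isUnit {P : Matrix m m R} {Q : Matrix n n R} (hP : IsUnit P) (hQ : IsUnit Q)
    (M : Matrix m n R) : UnitEquivalent M (P * M * Q) :=
  ⟨hP.unit, hQ.unit, rfl⟩

theorem refl (M : Matrix m n R) : UnitEquivalent M M := ⟨1, 1, by simp⟩

theorem symm {M N : Matrix m n R} (h : UnitEquivalent M N) : UnitEquivalent N M := by
  obtain ⟨P, Q, rfl⟩ := h
  refine ⟨P⁻¹, Q⁻¹, ?_⟩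
  simp only [← Matrix.mul_assoc, Units.inv_mul, Matrix.one_mul]
  rw [Matrix.mul_assoc, Units.mul_inv, Matrix.mul_one]

theorem trans {M N L : Matrix m n R} (h : UnitEquivalent M N) (h' : UnitEquivalent N L) :
    UnitEquivalent M L := by
  obtain ⟨P, Q, rfl⟩ := h
  obtain ⟨P', Q', rfl⟩ := h'
  exact ⟨P' * P, Q * Q', by simp only [Units.val_mul, Matrix.mul_assoc]⟩

theorem smul {M N : Matrix m n R} (c : R) (h : UnitEquivalent M N) :
    UnitEquivalent (c • M) (c • N) := by
  obtain ⟨P, Q, rfl⟩ := h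
  exact ⟨P, Q, by simp⟩

theorem map {S : Type*} [CommRing S] (φ : R →+* S) {M N : Matrix m n R}
    (h : UnitEquivalent M N) : UnitEquivalent (M.map φ) (N.map φ) := by
  obtain ⟨P, Q, rfl⟩ := h
  exact ⟨Units.map φ.mapMatrix.toMonoidHom P, Units.map φ.mapMatrix.toMonoidHom Q,
    by simp [Matrix.map_mul]⟩

theorem submatrix {M N : Matrix m n R} (h : UnitEquivalent M N) (e : m' ≃ m) (f : n' ≃ n) :
    UnitEquivalent (M.submatrix e f) (N.submatrix e f) := by
  obtain ⟨P, Q, rfl⟩ := h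
  have h := of_isUnit (P := P.val.submatrix e e) (Q := Q.val.submatrix f f)
    ((Matrix.isUnit_submatrix_equiv e e).2 P.isUnit)
    ((Matrix.isUnit_submatrix_equiv f f).2 Q.isUnit) (M.submatrix e f)
  rwa [Matrix.submatrix_mul_equiv, Matrix.submatrix_mul_equiv] at h

theorem submatrix_perm (M : Matrix m n R) (σ : Equiv.Perm m) (τ : Equiv.Perm n) :
    UnitEquivalent M (M.submatrix σ τ) := by
  have h := of_isUnit (P := (1 : Matrix m m R).submatrix σ (Equiv.refl m))
    (Q := (1 : Matrix n n R).submatrix (Equiv.refl n) τ)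
    ((Matrix.isUnit_submatrix_equiv _ _).2 isUnit_one)
    ((Matrix.isUnit_submatrix_equiv _ _).2 isUnit_one) M
  have e : M = M.submatrix (Equiv.refl m) (Equiv.refl n) := rfl
  nth_rewrite 2 [e] at h
  rwa [Matrix.submatrix_mul_equiv, Matrix.submatrix_mul_equiv, Matrix.one_mul,
    Matrix.mul_one] at h

theorem fromBlocks {M N : Matrix m n R} (h : UnitEquivalent M N) {D E : Matrix m' n' R}
    (h' : UnitEquivalent D E) :
    UnitEquivalent (Matrix.fromBlocks M 0 0 D) (Matrix.fromBlocks N 0 0 E) := by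
  obtain ⟨P, Q, rfl⟩ := h
  obtain ⟨P', Q', rfl⟩ := h'
  have h := of_isUnit (P := Matrix.fromBlocks P.val 0 0 P'.val)
    (Q := Matrix.fromBlocks Q.val 0 0 Q'.val)
    ((Matrix.isUnit_fromBlocks_zero₁₂).2 ⟨P.isUnit, P'.isUnit⟩)
    ((Matrix.isUnit_fromBlocks_zero₁₂).2 ⟨Q.isUnit, Q'.isUnit⟩) (Matrix.fromBlocks M 0 0 D)
  simpa [Matrix.fromBlocks_multiply] using h

/-- Clearing the row and the column of an invertible block. -/
theorem fromBlocks_schur (A : Matrix m n R) (B : Matrix m m' R) (C : Matrix m' n R)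
    (D : Matrix m' m' R) (hD : IsUnit D) :
    ∃ S : Matrix m n R,
      UnitEquivalent (Matrix.fromBlocks A B C D) (Matrix.fromBlocks S 0 0 1) := by
  let := hD.invertible
  refine ⟨A - B * ⅟D * C, ?_⟩
  have h₁ : UnitEquivalent D 1 := UnitEquivalent.symm ⟨hD.unit, 1, by simp⟩
  refine UnitEquivalent.trans ?_ ((UnitEquivalent.refl _).fromBlocks h₁)
  rw [Matrix.fromBlocks_eq_of_invertible₂₂ A B C D]
  refine (of_isUnit ?_ ?_ _).symm
  · exact Matrix.isUnit_fromBlocks_zero₂₁.2 ⟨isUnit_one, isUnit_one⟩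
  · exact Matrix.isUnit_fromBlocks_zero₁₂.2 ⟨isUnit_one, isUnit_one⟩

end UnitEquivalent

end Matrix

theorem mem_matrixOrbit {r s : ℕ} {K : Type*} [Field K]
    {M N : Matrix (Fin r) (Fin s) (PowerSeries K)} :
    N ∈ matrixOrbit M ↔ M.UnitEquivalent N := by
  constructor
  · rintro ⟨g, h, e⟩
    exact ⟨g, h⁻¹, e⟩
  · rintro ⟨g, h, e⟩
    exact ⟨g, h⁻¹, by rw [inv_inv]; exact e⟩

/-! ### Diagonal arcs and the Smith normal form -/

/-- The `r × s` matrix over `K⟦t⟧` whose last `r` columns form the diagonal matrix with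
entries `t ^ f i`. -/
noncomputable def diagArc (K : Type*) [Field K] {r : ℕ} (s : ℕ) (f : Fin r → ℕ∞) :
    Matrix (Fin r) (Fin s) (PowerSeries K) :=
  Matrix.of fun i j => if j.val + r = i.val + s then tPowOver K (f i) else 0

theorem deltaMatrix_eq_diagArc {r : ℕ} (s : ℕ) (lam : PrePartition r) :
    deltaMatrix s lam = diagArc ℂ s lam.terms := rfl

theorem diagArc_map {K L : Type*} [Field K] [Field L] (φ : K →+* L) {r : ℕ} (s : ℕ)
    (f : Fin r → ℕ∞) : (diagArc K s f).map (PowerSeries.map φ) = diagArc L s f := by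
  ext1 i j
  simp only [diagArc, Matrix.map_apply, Matrix.of_apply]
  split_ifs <;> simp [map_tPowOver]

/-- The inductive step of the Smith form: once `t ^ b` is factored out and a unit entry is split
off, the other exponents are all shifted by `b`, so that the new last one is the smallest. -/
theorem diagArc_snoc (K : Type*) [Field K] {r s : ℕ} (f : Fin r → ℕ∞) (b : ℕ) :
    diagArc K (s + 1) (Fin.snoc (fun i => f i + b) (b : ℕ∞) : Fin (r + 1) → ℕ∞) =
      (PowerSeries.X : PowerSeries K) ^ b •
        (Matrix.fromBlocks (diagArc K s f) 0 0 (1 : Matrix (Fin 1) (Fin 1) _)).submatrix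
          finSumFinEquiv.symm finSumFinEquiv.symm := by
  ext1 i j
  have h1 : ∀ i : Fin r, i.castSucc = Fin.castAdd 1 i := fun _ => rfl
  have h2 : ∀ n : ℕ, Fin.last n = Fin.natAdd n (0 : Fin 1) := fun _ => rfl
  have h3 : ∀ i : Fin s, i.castSucc = Fin.castAdd 1 i := fun _ => rfl
  refine Fin.lastCases ?_ (fun i => ?_) i <;> refine Fin.lastCases ?_ (fun j => ?_) j
  · simp only [diagArc, Matrix.of_apply, Fin.snoc_last]
    rw [if_pos (by simp; omega), h2, h2]
    simp
  · simp only [diagArc, Matrix.of_apply, Fin.snoc_last]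
    rw [if_neg (by simp; omega), h2, h3]
    simp
  · simp only [diagArc, Matrix.of_apply, Fin.snoc_castSucc]
    rw [if_neg (by simp; omega), h2, h1]
    simp
  · simp only [diagArc, Matrix.of_apply, Fin.snoc_castSucc, Fin.val_castSucc]
    rw [h1, h3]
    simp only [Matrix.smul_apply, Matrix.submatrix_apply, finSumFinEquiv_symm_apply_castAdd,
      Matrix.fromBlocks_apply₁₁, Matrix.of_apply, smul_eq_mul]
    by_cases h : (j : ℕ) + r = i + s
    · rw [if_pos h, if_pos (by omega), tPowOver_add, mul_comm, tPowOver_coe]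
    · rw [if_neg h, if_neg (by omega), mul_zero]

/-- A nonzero matrix of power series is a power of `t` times a matrix with a unit entry. -/
theorem exists_eq_X_pow_smul {K m n : Type*} [Field K] (M : Matrix m n (PowerSeries K))
    (hM : M ≠ 0) : ∃ (b : ℕ) (M' : Matrix m n (PowerSeries K)) (i : m) (j : n),
      M = (PowerSeries.X : PowerSeries K) ^ b • M' ∧ IsUnit (M' i j) := by
  classical
  have hex : ∃ b : ℕ, ∃ i j, PowerSeries.coeff b (M i j) ≠ 0 := by
    by_contra! h
    exact hM (by ext i j b; simpa using h b i j)
  have hmin := fun b (hb : b < Nat.find hex) => Nat.find_min hex hb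
  obtain ⟨i, j, hij⟩ := Nat.find_spec hex
  generalize Nat.find hex = b at hmin hij
  push Not at hmin
  have hdvd : ∀ i j, (PowerSeries.X : PowerSeries K) ^ b ∣ M i j := fun i j =>
    PowerSeries.X_pow_dvd_iff.2 fun m hm => hmin m hm i j
  choose M' hM' using hdvd
  refine ⟨b, Matrix.of M', i, j, by ext1 i j; simp [hM'], ?_⟩
  rw [PowerSeries.isUnit_iff_constantCoeff, isUnit_iff_ne_zero]
  rw [hM'] at hij
  have := PowerSeries.coeff_X_pow_mul (M' i j) b 0
  rw [zero_add] at this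
  rw [this] at hij
  simpa using hij

/-- Smith normal form over `K⟦t⟧`. -/
theorem exists_unitEquivalent_diagArc {K : Type*} [Field K] {r s : ℕ} (hrs : r ≤ s)
    (M : Matrix (Fin r) (Fin s) (PowerSeries K)) :
    ∃ lam : PrePartition r, (diagArc K s lam.terms).UnitEquivalent M := by
  induction r generalizing s with
  | zero =>
    refine ⟨⟨fun i => i.elim0, fun i => i.elim0⟩, ?_⟩
    rw [Subsingleton.elim (diagArc K s _) M]
    exact .refl _
  | succ r ih =>
    obtain ⟨s, rfl⟩ : ∃ s', s = s' + 1 := ⟨s - 1, by omega⟩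
    by_cases hM : M = 0
    · refine ⟨⟨fun _ => ⊤, fun _ _ _ => le_rfl⟩, ?_⟩
      have : diagArc K (s + 1) (fun _ : Fin (r + 1) => ⊤) = M := by
        rw [hM]; ext1 i j; simp [diagArc]
      rw [this]
      exact .refl _
    obtain ⟨b, M', i, j, rfl, hu⟩ := exists_eq_X_pow_smul M hM
    -- The two swaps bring the unit entry to the last corner, where it serves as the pivot of a
    -- Schur complement.
    set N := (M'.submatrix (Equiv.swap i (Fin.last r)) (Equiv.swap j (Fin.last s))).submatrix
      (finSumFinEquiv (m := r) (n := 1)) (finSumFinEquiv (m := s) (n := 1)) with hN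
    have hD : IsUnit N.toBlocks₂₂ := by
      rw [Matrix.isUnit_iff_isUnit_det]
      have e1 : (Fin.natAdd r (0 : Fin 1)) = Fin.last r := rfl
      have e2 : (Fin.natAdd s (0 : Fin 1)) = Fin.last s := rfl
      simpa [hN, Matrix.toBlocks₂₂, e1, e2] using hu
    obtain ⟨S, hS⟩ := Matrix.UnitEquivalent.fromBlocks_schur N.toBlocks₁₁ N.toBlocks₁₂
      N.toBlocks₂₁ N.toBlocks₂₂ hD
    rw [Matrix.fromBlocks_toBlocks] at hS
    obtain ⟨lam, hlam⟩ := ih (s := s) (by omega) S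
    have hS' := (hS.trans (hlam.symm.fromBlocks (.refl 1))).submatrix
      (finSumFinEquiv (m := r) (n := 1)).symm (finSumFinEquiv (m := s) (n := 1)).symm
    have hN' : N.submatrix finSumFinEquiv.symm finSumFinEquiv.symm =
        M'.submatrix (Equiv.swap i (Fin.last r)) (Equiv.swap j (Fin.last s)) := by
      ext1 i j
      simp [hN]
    rw [hN'] at hS'
    have key := ((Matrix.UnitEquivalent.submatrix_perm M' _ _).trans hS').smul
      ((PowerSeries.X : PowerSeries K) ^ b)
    rw [← diagArc_snoc] at key
    refine ⟨⟨Fin.snoc (fun i => lam.terms i + b) (b : ℕ∞), ?_⟩, key.symm⟩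
    intro i j
    refine Fin.lastCases ?_ (fun i => ?_) i <;> refine Fin.lastCases ?_ (fun j => ?_) j
    · simp
    · intro h
      exact absurd h (by simp [Fin.le_def])
    · simp
    · intro h
      simpa using add_le_add_left (lam.anti (by simpa using h)) (b : ℕ∞)

/-! ### Points of the arc space -/

section Points

variable {r s : ℕ} {K : Type*} [Field K] [Algebra ℂ K]

/-- Evaluation of a function on the arc space at a `K`-valued arc. -/
noncomputable abbrev arcEval (M : Matrix (Fin r) (Fin s) (PowerSeries K)) :
    ArcRing r s →ₐ[ℂ] K :=
  (arcEquiv r s K).symm M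

theorem mem_arcPoint {M : Matrix (Fin r) (Fin s) (PowerSeries K)} {f : ArcRing r s} :
    f ∈ (arcPoint M).asIdeal ↔ arcEval M f = 0 := by
  simp [arcPoint, PrimeSpectrum.comap_asIdeal]

@[simp] theorem arcEval_X (M : Matrix (Fin r) (Fin s) (PowerSeries K)) (v : Fin r × Fin s × ℕ) :
    arcEval M (MvPolynomial.X v) = PowerSeries.coeff v.2.2 (M v.1 v.2.1) := by
  simp [arcEval, arcEquiv]

theorem arcEval_eq_aeval (M : Matrix (Fin r) (Fin s) (PowerSeries K)) (f : ArcRing r s) :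
    arcEval M f = MvPolynomial.aeval (fun v => PowerSeries.coeff v.2.2 (M v.1 v.2.1)) f :=
  rfl

theorem arcPoint_mem_closure {T : Set (ArcSpace r s)}
    {M : Matrix (Fin r) (Fin s) (PowerSeries K)} :
    arcPoint M ∈ closure T ↔
      ∀ f : ArcRing r s, (∀ p ∈ T, f ∈ p.asIdeal) → arcEval M f = 0 := by
  rw [← PrimeSpectrum.zeroLocus_vanishingIdeal_eq_closure, PrimeSpectrum.mem_zeroLocus]
  simp only [Set.subset_def, SetLike.mem_coe, PrimeSpectrum.mem_vanishingIdeal, mem_arcPoint]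

theorem arcEval_map {L : Type*} [Field L] [Algebra ℂ L] (φ : K →ₐ[ℂ] L)
    (M : Matrix (Fin r) (Fin s) (PowerSeries K)) :
    arcEval (M.map (PowerSeries.map (φ : K →+* L))) = φ.comp (arcEval M) := by
  apply MvPolynomial.algHom_ext
  intro v
  simp

theorem arcPoint_map {L : Type*} [Field L] [Algebra ℂ L] (φ : K →ₐ[ℂ] L)
    (M : Matrix (Fin r) (Fin s) (PowerSeries K)) :
    arcPoint (M.map (PowerSeries.map (φ : K →+* L))) = arcPoint M := by
  ext f
  rw [mem_arcPoint, mem_arcPoint, arcEval_map]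
  simp

theorem arcPoint_diagArc (f : Fin r → ℕ∞) :
    arcPoint (diagArc K s f) = arcPoint (diagArc ℂ s f) := by
  rw [← arcPoint_map (Algebra.ofId ℂ K), diagArc_map]

/-- An arc over `K` at a complex point is the complex arc. -/
theorem eq_map_of_arcPoint_eq {M : Matrix (Fin r) (Fin s) (PowerSeries K)}
    {N : Matrix (Fin r) (Fin s) (PowerSeries ℂ)} (h : arcPoint M = arcPoint N) :
    M = N.map (PowerSeries.map (algebraMap ℂ K)) := by
  ext i j n
  have hmem : (MvPolynomial.X (i, j, n) - MvPolynomial.C (PowerSeries.coeff n (N i j)) :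
      ArcRing r s) ∈ (arcPoint N).asIdeal := by
    rw [mem_arcPoint]
    simp [arcEval_eq_aeval]
  rw [← h, mem_arcPoint] at hmem
  simpa [arcEval_eq_aeval, sub_eq_zero] using hmem

theorem exists_arcPoint_eq (p : ArcSpace r s) :
    ∃ (K : Type) (_ : Field K) (_ : Algebra ℂ K) (M : Matrix (Fin r) (Fin s) (PowerSeries K)),
      arcPoint M = p := by
  -- The reduction of the universal arc modulo `p`; the kernel of evaluation at it is `p`.
  refine ⟨p.asIdeal.ResidueField, inferInstance, inferInstance,
    arcEquiv r s _ (Algebra.algHom ℂ (ArcRing r s) p.asIdeal.ResidueField), ?_⟩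
  ext f
  rw [mem_arcPoint, arcEval, Equiv.symm_apply_apply]
  exact Ideal.algebraMap_residueField_eq_zero

/-- Two extensions of `ℂ` have a common extension. -/
theorem exists_common_extension (K L : Type) [Field K] [Field L] [Algebra ℂ K] [Algebra ℂ L] :
    ∃ (F : Type) (_ : Field F) (_ : Algebra ℂ F), Nonempty (K →ₐ[ℂ] F) ∧ Nonempty (L →ₐ[ℂ] F) := by
  -- A tensor product of fields over a field is nonzero, and both factors map to any residue field
  -- of it.
  obtain ⟨m, hm⟩ := Ideal.exists_maximal (TensorProduct ℂ K L)
  let := Ideal.Quotient.field m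
  exact ⟨TensorProduct ℂ K L ⧸ m, inferInstance, inferInstance,
    ⟨(Ideal.Quotient.mkₐ ℂ m).comp Algebra.TensorProduct.includeLeft⟩,
    ⟨(Ideal.Quotient.mkₐ ℂ m).comp Algebra.TensorProduct.includeRight⟩⟩

end Points

/-! ### Divisibility of minors -/

namespace Matrix

/-- All minors of `M` with rows and columns indexed by `ι` are divisible by `d`. -/
def DvdMinors {m n R : Type*} [CommRing R] (ι : Type*) [Fintype ι] [DecidableEq ι] (d : R)
    (M : Matrix m n R) : Prop :=
  ∀ (ρ : ι → m) (σ : ι → n), d ∣ (M.submatrix ρ σ).det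

namespace DvdMinors

variable {m n l R ι : Type*} [CommRing R] [Fintype ι] [DecidableEq ι] {d : R}

theorem transpose {M : Matrix m n R} (h : DvdMinors ι d M) : DvdMinors ι d Mᵀ := by
  intro ρ σ
  rw [← Matrix.transpose_submatrix, Matrix.det_transpose]
  exact h σ ρ

/-- The rows of `P * M` are combinations of rows of `M`, and the determinant is multilinear in rows.
Row choices with repetitions occur in the expansion, which is why `DvdMinors` allows non-injective
index maps. -/
theorem mul_left [Fintype m] {M : Matrix m n R} (h : DvdMinors ι d M) (P : Matrix l m R) :
    DvdMinors ι d (P * M) := by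
  intro ρ σ
  have e : ((P * M).submatrix ρ σ).det =
      Matrix.detRowAlternating.toMultilinearMap
        (fun i => ∑ j, P (ρ i) j • (M.submatrix id σ) j) := by
    congr 1
    ext i k
    simp [Matrix.mul_apply]
  rw [e, MultilinearMap.map_sum]
  refine Finset.dvd_sum fun τ _ => ?_
  rw [MultilinearMap.map_smul_univ]
  exact Dvd.dvd.mul_left (h τ σ) _

theorem mul_right [Fintype n] {M : Matrix m n R} (h : DvdMinors ι d M) (Q : Matrix n l R) :
    DvdMinors ι d (M * Q) := by
  have := (h.transpose.mul_left Qᵀ).transpose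
  rwa [← Matrix.transpose_mul, Matrix.transpose_transpose] at this

theorem of_unitEquivalent [Fintype m] [Fintype n] [DecidableEq m] [DecidableEq n]
    {M N : Matrix m n R} (h : DvdMinors ι d M) (hMN : M.UnitEquivalent N) :
    DvdMinors ι d N := by
  obtain ⟨P, Q, rfl⟩ := hMN
  exact (h.mul_left _).mul_right _

end DvdMinors

end Matrix

/-- Among all sums of terms of an antitone sequence, with a given number of terms, the tail sum
is the smallest. -/
theorem sum_Ici_le_sum_of_card_eq {r : ℕ} {f : Fin r → ℕ∞} (hf : Antitone f) (i : Fin r)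
    (S : Finset (Fin r)) (hS : S.card = (Finset.Ici i).card) :
    ∑ j ∈ Finset.Ici i, f j ≤ ∑ j ∈ S, f j := by
  rw [← Finset.sum_inter_add_sum_sdiff (Finset.Ici i) S f,
    ← Finset.sum_inter_add_sum_sdiff S (Finset.Ici i) f, Finset.inter_comm]
  gcongr 1
  -- An exchange argument: outside the intersection both sets have equally many elements, with terms
  -- at most `f i` on one side and at least `f i` on the other.
  calc ∑ j ∈ Finset.Ici i \ S, f j ≤ (Finset.Ici i \ S).card • f i :=
        Finset.sum_le_card_nsmul _ _ _ fun j hj => hf (by simp at hj; exact hj.1)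
    _ = (S \ Finset.Ici i).card • f i := by
        rw [Finset.card_sdiff_comm hS]
    _ ≤ _ := Finset.card_nsmul_le_sum _ _ _ fun j hj => hf (by simp at hj; exact hj.2.le)

theorem diagArc_submatrix_det {K : Type*} [Field K] {r s : ℕ} (f : Fin r → ℕ∞)
    {ι : Type*} [Fintype ι] [DecidableEq ι] (ρ : ι → Fin r) (σ : ι → Fin s) :
    ((diagArc K s f).submatrix ρ σ).det = tPowOver K (∑ i, f (ρ i)) *
      ((diagArc K s (fun _ => 0)).submatrix ρ σ).det := by
  have e : (diagArc K s f).submatrix ρ σ = Matrix.diagonal (fun i => tPowOver K (f (ρ i))) *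
      (diagArc K s (fun _ => 0)).submatrix ρ σ := by
    ext1 i j
    simp [diagArc, Matrix.diagonal_mul]
  rw [e, Matrix.det_mul, Matrix.det_diagonal, tPowOver_sum]

theorem dvdMinors_diagArc {K : Type*} [Field K] {r s : ℕ} {f : Fin r → ℕ∞} (hf : Antitone f)
    (i : Fin r) : Matrix.DvdMinors (Finset.Ici i) (tPowOver K (∑ j ∈ Finset.Ici i, f j))
      (diagArc K s f) := by
  intro ρ σ
  by_cases hρ : Function.Injective ρ
  · rw [diagArc_submatrix_det]
    refine Dvd.dvd.mul_right (tPowOver_dvd_tPowOver.2 ?_) _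
    have := sum_Ici_le_sum_of_card_eq hf i (Finset.univ.map ⟨ρ, hρ⟩) (by simp)
    simpa using this
  · simp only [Function.Injective, not_forall] at hρ
    obtain ⟨a, b, hab, hne⟩ := hρ
    rw [Matrix.det_zero_of_row_eq hne (by ext1 j; simp [hab])]
    exact dvd_zero _

/-- The minor on the rows from `i` on and the matching columns is exactly `t` to the tail sum. -/
theorem sum_le_of_dvdMinors_diagArc {K : Type*} [Field K] {r s : ℕ} (hrs : r ≤ s)
    {f : Fin r → ℕ∞} {i : Fin r} {a : ℕ∞}
    (h : Matrix.DvdMinors (Finset.Ici i) (tPowOver K a) (diagArc K s f)) :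
    a ≤ ∑ j ∈ Finset.Ici i, f j := by
  have h' := h Subtype.val (fun j => ⟨j.1 + (s - r), by omega⟩)
  rw [diagArc_submatrix_det] at h'
  have e : (diagArc K s (fun _ => 0)).submatrix (Subtype.val : Finset.Ici i → Fin r)
      (fun j : Finset.Ici i => (⟨j.1 + (s - r), by omega⟩ : Fin s)) = 1 := by
    ext1 a b
    have : ((b : Fin r) : ℕ) + (s - r) + r = (a : Fin r) + s ↔ a = b := by
      rw [Subtype.ext_iff, Fin.ext_iff]; omega
    simp [diagArc, Matrix.one_apply, this]
  rw [e, Matrix.det_one, mul_one, tPowOver_dvd_tPowOver] at h'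
  refine h'.trans (le_of_eq ?_)
  exact Finset.sum_coe_sort (Finset.Ici i) f

/-- The universal arc. -/
noncomputable def universalArc (r s : ℕ) : Matrix (Fin r) (Fin s) (PowerSeries (ArcRing r s)) :=
  arcEquiv r s (ArcRing r s) (AlgHom.id ℂ _)

/-- Every arc is a specialization of the universal one, so the coefficients of its minors are values
of regular functions on the arc space. -/
theorem coeff_minor_eq_arcEval {r s : ℕ} {K : Type*} [Field K] [Algebra ℂ K]
    (M : Matrix (Fin r) (Fin s) (PowerSeries K)) {ι : Type*} [Fintype ι] [DecidableEq ι]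
    (ρ : ι → Fin r) (σ : ι → Fin s) (n : ℕ) :
    PowerSeries.coeff n (M.submatrix ρ σ).det =
      arcEval M (PowerSeries.coeff n ((universalArc r s).submatrix ρ σ).det) := by
  have e : M = (universalArc r s).map (PowerSeries.map (arcEval M : ArcRing r s →+* K)) := by
    ext i j n
    simp [universalArc, arcEquiv]
  conv_lhs => rw [e]
  have := (RingHom.map_det (PowerSeries.map (arcEval M : ArcRing r s →+* K))
    ((universalArc r s).submatrix ρ σ)).symm
  rw [RingHom.mapMatrix_apply, ← Matrix.submatrix_map] at this
  rw [this]
  simp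

/-- Divisibility of all minors by a power of `t` is a closed condition. -/
theorem dvdMinors_of_mem_closure {r s : ℕ} {K : Type*} [Field K] [Algebra ℂ K]
    {ι : Type*} [Fintype ι] [DecidableEq ι] {a : ℕ∞} {T : Set (ArcSpace r s)}
    (hT : ∀ p ∈ T, ∃ (L : Type) (_ : Field L) (_ : Algebra ℂ L)
      (M : Matrix (Fin r) (Fin s) (PowerSeries L)),
      arcPoint M = p ∧ M.DvdMinors ι (tPowOver L a))
    {N : Matrix (Fin r) (Fin s) (PowerSeries K)} (hN : arcPoint N ∈ closure T) :
    N.DvdMinors ι (tPowOver K a) := by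
  intro ρ σ
  rw [tPowOver_dvd_iff]
  intro n hn
  rw [coeff_minor_eq_arcEval]
  refine arcPoint_mem_closure.1 hN _ fun p hp => ?_
  obtain ⟨L, _, _, M, rfl, hM⟩ := hT p hp
  rw [mem_arcPoint, ← coeff_minor_eq_arcEval]
  exact tPowOver_dvd_iff.1 (hM ρ σ) n hn

/-! ### Elementary degenerations of exponents -/

/-- The elementary moves on exponents: increasing one of them, or moving a smaller and a larger
one towards each other with their sum unchanged. -/
inductive DegenerationStep {ι : Type*} [DecidableEq ι] : (ι → ℕ∞) → (ι → ℕ∞) → Prop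
  | raise (f : ι → ℕ∞) (i : ι) (a : ℕ∞) (h : f i ≤ a) :
      DegenerationStep f (Function.update f i a)
  | shift (f : ι → ℕ∞) (i j : ι) (b c d : ℕ) (hij : i ≠ j) (hi : f i = (b : ℕ∞))
      (hj : f j = ((b + c + d : ℕ) : ℕ∞)) :
      DegenerationStep f
        (Function.update (Function.update f i ((b + c : ℕ) : ℕ∞)) j ((b + d : ℕ) : ℕ∞))

namespace DegenerationStep

theorem comp_equiv {ι κ : Type*} [DecidableEq ι] [DecidableEq κ] (e : κ ≃ ι) {f g : ι → ℕ∞}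
    (h : DegenerationStep f g) : DegenerationStep (f ∘ e) (g ∘ e) := by
  cases h with
  | raise i a h =>
    rw [Function.update_comp_equiv]
    exact .raise _ _ _ (by simpa using h)
  | shift i j b c d hij hi hj =>
    rw [Function.update_comp_equiv, Function.update_comp_equiv]
    exact .shift _ _ _ _ _ _ (by simpa using hij) (by simpa using hi) (by simpa using hj)

theorem cons {n : ℕ} (x : ℕ∞) {f g : Fin n → ℕ∞} (h : DegenerationStep f g) :
    DegenerationStep (Fin.cons x f : Fin (n + 1) → ℕ∞) (Fin.cons x g) := by
  cases h with
  | raise i a h =>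
    rw [Fin.cons_update]
    exact .raise _ _ _ (by simpa using h)
  | shift i j b c d hij hi hj =>
    rw [Fin.cons_update, Fin.cons_update]
    exact .shift _ _ _ _ _ _ (by simpa using hij) (by simpa using hi) (by simpa using hj)

end DegenerationStep

theorem Fin.sum_Iic_succ {n : ℕ} {M : Type*} [AddCommMonoid M] (f : Fin (n + 1) → M)
    (k : Fin n) : ∑ j ∈ Finset.Iic k.succ, f j = f 0 + ∑ j ∈ Finset.Iic k, f j.succ := by
  have e : Finset.Iic k.succ =
      Finset.cons 0 ((Finset.Iic k).map (Fin.succEmb n)) (by simp) := by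
    ext j
    refine Fin.cases ?_ (fun j => ?_) j <;> simp
  rw [e, Finset.sum_cons, Finset.sum_map]
  rfl

/-- The first exponent can be adjusted by elementary moves, with the bounds on the partial sums
of the remaining ones preserved. -/
theorem exists_degeneration_head_eq {n : ℕ} {lam mu : Fin (n + 1) → ℕ∞} (hmu : Monotone mu)
    (h : ∀ k, ∑ j ∈ Finset.Iic k, lam j ≤ ∑ j ∈ Finset.Iic k, mu j) :
    ∃ nu : Fin (n + 1) → ℕ∞, Relation.ReflTransGen DegenerationStep lam nu ∧ nu 0 = mu 0 ∧
      ∀ k : Fin n, ∑ j ∈ Finset.Iic k, nu j.succ ≤ ∑ j ∈ Finset.Iic k, mu j.succ := by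
  have h0 : lam 0 ≤ mu 0 := by
    have e : Finset.Iic (0 : Fin (n + 1)) = {0} := by ext j; simp
    simpa [e] using h 0
  have hraise : Relation.ReflTransGen DegenerationStep lam (Function.update lam 0 (mu 0)) :=
    .single (.raise _ _ _ h0)
  have hsucc : ∀ k : Fin n,
      lam 0 + ∑ j ∈ Finset.Iic k, lam j.succ ≤ mu 0 + ∑ j ∈ Finset.Iic k, mu j.succ := by
    intro k
    have := h k.succ
    rwa [Fin.sum_Iic_succ, Fin.sum_Iic_succ] at this
  have hterm : ∀ (nu : Fin (n + 1) → ℕ∞) (k : Fin n), (∀ j ≤ k, nu j.succ ≤ mu 0) →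
      ∑ j ∈ Finset.Iic k, nu j.succ ≤ ∑ j ∈ Finset.Iic k, mu j.succ := fun nu k hk =>
    Finset.sum_le_sum fun j hj => (hk j (Finset.mem_Iic.1 hj)).trans (hmu (Fin.zero_le _))
  by_cases hall : ∀ j : Fin n, lam j.succ ≤ mu 0
  -- All other exponents are at most `mu 0`, the least term of `mu`, so raising the head suffices
  -- and the tails compare term by term.
  · refine ⟨_, hraise, by simp, fun k => hterm _ k fun j _ => ?_⟩
    simpa using hall j
  push Not at hall
  -- Taking the first exponent above `mu 0` matters: partial sums stopping before it are bounded
  -- term by term, and later ones contain it.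
  obtain ⟨k, hk, hkmin⟩ : ∃ k : Fin n, mu 0 < lam k.succ ∧ ∀ j < k, lam j.succ ≤ mu 0 := by
    obtain ⟨k, hk, hmin⟩ := WellFounded.has_min (wellFounded_lt (α := Fin n))
      {k | mu 0 < lam k.succ} hall
    exact ⟨k, hk, fun j hj => not_lt.1 fun hj' => hmin j hj' hj⟩
  obtain ⟨m, hm⟩ : ∃ m : ℕ, mu 0 = m := ⟨_, (ENat.natCast_toNat hk.ne_top).symm⟩
  obtain ⟨b, hb⟩ : ∃ b : ℕ, lam 0 = b :=
    ⟨_, (ENat.natCast_toNat (h0.trans_lt hk).ne_top).symm⟩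
  have hcancel : ∀ x y : ℕ∞, mu 0 + x ≤ mu 0 + y → x ≤ y := fun x y hxy =>
    (ENat.add_le_add_iff_left hk.ne_top).1 hxy
  by_cases htop : lam k.succ = ⊤
  · refine ⟨_, hraise, by simp, fun l => ?_⟩
    simp only [ne_eq, Fin.succ_ne_zero, not_false_eq_true, Function.update_of_ne]
    rcases lt_or_ge l k with hl | hl
    · exact hterm _ l fun j hj => hkmin j (hj.trans_lt hl)
    · refine hcancel _ _ (le_trans ?_ (hsucc l))
      have : ∑ j ∈ Finset.Iic l, lam j.succ = ⊤ :=
        WithTop.sum_eq_top.2 ⟨k, Finset.mem_Iic.2 hl, htop⟩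
      rw [this]
      simp
  · obtain ⟨a, ha⟩ : ∃ a : ℕ, lam k.succ = a := ⟨_, (ENat.natCast_toNat htop).symm⟩
    rw [hm, hb, Nat.cast_le] at h0
    rw [hm, ha, Nat.cast_lt] at hk
    obtain ⟨c, rfl⟩ := Nat.exists_eq_add_of_le h0
    obtain ⟨d, rfl⟩ := Nat.exists_eq_add_of_le hk.le
    -- Here `c = mu 0 - lam 0` is moved from the large exponent to the head. Partial sums reaching
    -- `k` keep their total, so the old bound survives cancelling `mu 0`. The result need not be
    -- sorted; only `mu` has to be.
    refine ⟨_, .single (.shift lam 0 k.succ b c d (Fin.succ_ne_zero k).symm hb ha),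
      by rw [Function.update_of_ne (Fin.succ_ne_zero k).symm, Function.update_self, hm],
      fun l => ?_⟩
    have e : ∀ j : Fin n, Function.update (Function.update lam 0 ((b + c : ℕ) : ℕ∞)) k.succ
        ((b + d : ℕ) : ℕ∞) j.succ =
        Function.update (fun j : Fin n => lam j.succ) k ((b + d : ℕ) : ℕ∞) j := by
      intro j
      by_cases hj : j = k
      · subst hj; simp
      · rw [Function.update_of_ne (by simpa using hj), Function.update_of_ne (by simp),
          Function.update_of_ne hj]
    rcases lt_or_ge l k with hl | hl
    · refine hterm _ l fun j hj => ?_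
      rw [e, Function.update_of_ne (hj.trans_lt hl).ne]
      exact hkmin j (hj.trans_lt hl)
    · refine hcancel _ _ (le_trans (le_of_eq ?_) (hsucc l))
      have hkl : k ∈ Finset.Iic l := Finset.mem_Iic.2 hl
      simp only [e]
      rw [Finset.sum_update_of_mem hkl, hm, hb,
        ← Finset.add_sum_erase _ (fun j : Fin n => lam j.succ) hkl, ha,
        Finset.sdiff_singleton_eq_erase]
      push_cast
      ring

/-- Domination of partial sums is generated by the elementary moves. -/
theorem degeneration_of_sum_Iic_le {n : ℕ} {lam mu : Fin n → ℕ∞} (hmu : Monotone mu)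
    (h : ∀ k, ∑ j ∈ Finset.Iic k, lam j ≤ ∑ j ∈ Finset.Iic k, mu j) :
    Relation.ReflTransGen DegenerationStep lam mu := by
  induction n with
  | zero => rw [Subsingleton.elim lam mu]
  | succ n ih =>
    obtain ⟨nu, hnu, h0, htail⟩ := exists_degeneration_head_eq hmu h
    have key : Relation.ReflTransGen DegenerationStep (Fin.cons (nu 0) (Fin.tail nu))
        (Fin.cons (nu 0) (Fin.tail mu) : Fin (n + 1) → ℕ∞) :=
      Relation.ReflTransGen.lift (fun f : Fin n → ℕ∞ => (Fin.cons (nu 0) f : Fin (n + 1) → ℕ∞))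
        (fun _ _ => DegenerationStep.cons (nu 0)) _ _ (ih (lam := Fin.tail nu) (mu := Fin.tail mu)
          (fun i j hij => hmu (Fin.succ_le_succ_iff.2 hij)) htail)
    rw [Fin.cons_self_tail, h0, Fin.cons_self_tail] at key
    exact hnu.trans key

theorem degeneration_of_le {r : ℕ} {lam mu : PrePartition r} (h : lam ≤ mu) :
    Relation.ReflTransGen DegenerationStep lam.terms mu.terms := by
  have e : ∀ (f : Fin r → ℕ∞) (k : Fin r),
      ∑ j ∈ Finset.Iic k, f (Fin.rev j) = ∑ j ∈ Finset.Ici k.rev, f j := by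
    intro f k
    refine Finset.sum_bij' (fun j _ => j.rev) (fun j _ => j.rev) ?_ ?_ ?_ ?_ ?_
    · intro j hj; simpa using hj
    · intro j hj
      rw [Finset.mem_Ici] at hj
      rw [Finset.mem_Iic, ← Fin.rev_le_rev]
      simpa using hj
    all_goals simp
  have key := degeneration_of_sum_Iic_le (lam := lam.terms ∘ Fin.revPerm)
    (mu := mu.terms ∘ Fin.revPerm) (fun i j hij => mu.anti (by simpa using hij)) fun k => by
      simpa [e] using h k.rev
  have := Relation.ReflTransGen.lift (· ∘ Fin.revPerm)
    (fun _ _ => DegenerationStep.comp_equiv Fin.revPerm) _ _ key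
  simpa [Function.onFun, Function.comp_def] using this

/-! ### Degenerations of arcs -/

/-- A point on a line of arcs is in the closure of a set that contains all but finitely many
points of the line. -/
theorem arcPoint_mem_closure_of_line {r s : ℕ} {K : Type*} [Field K] [Algebra ℂ K]
    {A B : Matrix (Fin r) (Fin s) (PowerSeries K)}
    {S : Set (Matrix (Fin r) (Fin s) (PowerSeries K))} {F : Set K} (hF : F.Finite)
    (h : ∀ u ∉ F, A + u • B ∈ S) : arcPoint A ∈ closure (arcPoint '' S) := by
  rw [arcPoint_mem_closure]
  intro f hf
  -- Characteristic zero makes `K` infinite, so a polynomial on the line vanishing off a finite set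
  -- is zero.
  have := charZero_of_injective_algebraMap (algebraMap ℂ K).injective
  let φ : ArcRing r s →ₐ[ℂ] Polynomial K := MvPolynomial.aeval fun v =>
    Polynomial.C (PowerSeries.coeff v.2.2 (A v.1 v.2.1)) +
      Polynomial.X * Polynomial.C (PowerSeries.coeff v.2.2 (B v.1 v.2.1))
  have hφ : ∀ u : K, arcEval (A + u • B) =
      ((Polynomial.aeval u : Polynomial K →ₐ[K] K).restrictScalars ℂ).comp φ := by
    intro u
    apply MvPolynomial.algHom_ext
    intro v
    simp only [φ, arcEval_X, AlgHom.comp_apply, MvPolynomial.aeval_X]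
    simp
    ring
  have hroot : φ f = 0 := by
    apply Polynomial.eq_zero_of_infinite_isRoot
    refine hF.infinite_compl.mono fun u hu => ?_
    have h1 := hf _ ⟨_, h u hu, rfl⟩
    rw [mem_arcPoint, hφ] at h1
    simpa [Polynomial.IsRoot, Polynomial.aeval_def] using h1
  have h0 := hφ 0
  rw [zero_smul, add_zero] at h0
  rw [h0]
  simp [hroot]

/-- The group acts linearly, so it carries a line through `A` to a line through any other point of
the orbit of `A`. -/
theorem matrixOrbit_subset_closure_of_line {r s : ℕ} {K : Type*} [Field K] [Algebra ℂ K]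
    {A B D : Matrix (Fin r) (Fin s) (PowerSeries K)} {F : Set K} (hF : F.Finite)
    (h : ∀ u ∉ F, D.UnitEquivalent (A + u • B)) :
    arcPoint '' matrixOrbit A ⊆ closure (arcPoint '' matrixOrbit D) := by
  rintro _ ⟨N, hN, rfl⟩
  obtain ⟨P, Q, rfl⟩ := mem_matrixOrbit.1 hN
  refine arcPoint_mem_closure_of_line (B := P.val * B * Q.val) hF fun u hu => ?_
  rw [mem_matrixOrbit]
  refine (h u hu).trans ⟨P, Q, ?_⟩
  simp [Matrix.mul_add, Matrix.add_mul]

section Moves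

variable {r s : ℕ} {K : Type*} [Field K]

/-- The column of the `i`-th entry of a diagonal arc. -/
def diagCol (hrs : r ≤ s) (i : Fin r) : Fin s := ⟨i + (s - r), by omega⟩

theorem diagCol_injective (hrs : r ≤ s) : Function.Injective (diagCol hrs) := by
  intro i j h
  simp only [diagCol, Fin.mk.injEq] at h
  exact Fin.ext (by omega)

theorem diagArc_apply (hrs : r ≤ s) (f : Fin r → ℕ∞) (i : Fin r) (j : Fin s) :
    diagArc K s f i j = if j = diagCol hrs i then tPowOver K (f i) else 0 := by
  have : j = diagCol hrs i ↔ j.val + r = i.val + s := by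
    simp only [diagCol, Fin.ext_iff]; omega
  simp [diagArc, this]

theorem diagArc_mul_single (hrs : r ≤ s) (f : Fin r → ℕ∞) {l : Type*} [DecidableEq l]
    (k : Fin r) (q : l) (x : PowerSeries K) :
    diagArc K s f * Matrix.single (diagCol hrs k) q x =
      Matrix.single k q (tPowOver K (f k) * x) := by
  ext1 a b
  by_cases hb : b = q
  · subst hb
    rw [Matrix.mul_single_apply_same, diagArc_apply hrs]
    by_cases ha : k = a
    · subst ha; simp
    · simp [ha, (diagCol_injective hrs).ne ha]
  · rw [Matrix.mul_single_apply_of_ne _ _ _ _ _ hb]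
    simp [Ne.symm hb]

theorem single_mul_diagArc (hrs : r ≤ s) (f : Fin r → ℕ∞) {l : Type*} [DecidableEq l]
    (p : l) (k : Fin r) (y : PowerSeries K) :
    Matrix.single p k y * diagArc K s f =
      Matrix.single p (diagCol hrs k) (y * tPowOver K (f k)) := by
  ext1 a b
  by_cases ha : a = p
  · subst ha
    rw [Matrix.single_mul_apply_same, diagArc_apply hrs]
    by_cases hb : b = diagCol hrs k
    · subst hb; simp
    · simp [hb, Ne.symm hb]
  · rw [Matrix.single_mul_apply_of_ne _ _ _ _ _ ha]
    simp [Ne.symm ha]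

theorem diagArc_update (hrs : r ≤ s) (f : Fin r → ℕ∞) (i : Fin r) (a : ℕ∞) :
    diagArc K s (Function.update f i a) = diagArc K s f +
      Matrix.single i (diagCol hrs i) (tPowOver K a - tPowOver K (f i)) := by
  ext1 k l
  rw [Matrix.add_apply, diagArc_apply hrs, diagArc_apply hrs, Matrix.single_apply]
  by_cases hk : i = k
  · subst hk
    by_cases hl : l = diagCol hrs i
    · simp [hl]
    · simp [hl, Ne.symm hl]
  · simp [hk, Function.update_of_ne (Ne.symm hk)]

theorem transvections_mul_diagArc (hrs : r ≤ s) (f : Fin r → ℕ∞) {i j : Fin r} (hij : i ≠ j)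
    (U V y : PowerSeries K) :
    Matrix.transvection j i y * diagArc K s f *
      (Matrix.transvection (diagCol hrs i) (diagCol hrs j) U *
        Matrix.transvection (diagCol hrs j) (diagCol hrs i) V) =
    diagArc K s f + Matrix.single i (diagCol hrs i) (tPowOver K (f i) * U * V) +
      Matrix.single i (diagCol hrs j) (tPowOver K (f i) * U) +
      Matrix.single j (diagCol hrs i) (tPowOver K (f j) * V + y * tPowOver K (f i) +
        y * tPowOver K (f i) * U * V) +
      Matrix.single j (diagCol hrs j) (y * tPowOver K (f i) * U) := by
  have hc := (diagCol_injective hrs).ne hij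
  simp only [Matrix.transvection, Matrix.add_mul, Matrix.mul_add, Matrix.one_mul, Matrix.mul_one,
    single_mul_diagArc hrs, diagArc_mul_single hrs, Matrix.single_mul_single_same,
    Matrix.single_mul_single_of_ne _ _ _ _ hc, Matrix.single_add, ← mul_assoc]
  abel

/-- On the two rows and columns concerned, the right side is `[[t^(b+c), u t^b], [0, t^(b+d)]]`. For
`u ≠ 0` its entries have gcd `t^b` and its determinant is `t^(2b+c+d)`, which gives the exponents
`b` and `b+c+d`; for `u = 0` it is the shifted diagonal. -/
theorem unitEquivalent_shift (hrs : r ≤ s) {f : Fin r → ℕ∞} {i j : Fin r} (hij : i ≠ j)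
    {b c d : ℕ} (hi : f i = (b : ℕ∞)) (hj : f j = ((b + c + d : ℕ) : ℕ∞)) {u : K} (hu : u ≠ 0) :
    (diagArc K s f).UnitEquivalent
      (diagArc K s (Function.update (Function.update f i ((b + c : ℕ) : ℕ∞)) j
        ((b + d : ℕ) : ℕ∞)) +
        u • Matrix.single i (diagCol hrs j) (PowerSeries.X ^ b)) := by
  have hU : (PowerSeries.C u : PowerSeries K) * PowerSeries.C u⁻¹ = 1 := by
    rw [← map_mul, mul_inv_cancel₀ hu, map_one]
  have htr : ∀ {n : ℕ} {k l : Fin n} (_ : k ≠ l) (x : PowerSeries K),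
      IsUnit (Matrix.transvection k l x) := fun h x => by
    rw [Matrix.isUnit_iff_isUnit_det, Matrix.det_transvection_of_ne _ _ h]
    exact isUnit_one
  have hc := (diagCol_injective hrs).ne hij
  -- The column operations create `u t^b` and turn the pivot `t^b` into `t^(b+c)`; the row operation
  -- clears the lower left entry and leaves `t^(b+d)` on the diagonal.
  have key := Matrix.UnitEquivalent.of_isUnit
    (htr hij.symm (PowerSeries.C u⁻¹ * (PowerSeries.X ^ d - PowerSeries.X ^ (c + d))))
    ((htr hc (PowerSeries.C u)).mul
      (htr hc.symm (PowerSeries.C u⁻¹ * (PowerSeries.X ^ c - 1)))) (diagArc K s f)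
  rw [transvections_mul_diagArc hrs f hij] at key
  convert key using 1
  rw [diagArc_update hrs, diagArc_update hrs, Function.update_of_ne hij.symm, hi, hj]
  simp only [tPowOver_coe]
  have e1 : (PowerSeries.X : PowerSeries K) ^ b * PowerSeries.C u *
      (PowerSeries.C u⁻¹ * (PowerSeries.X ^ c - 1)) =
      PowerSeries.X ^ (b + c) - PowerSeries.X ^ b := by
    linear_combination (PowerSeries.X ^ b * (PowerSeries.X ^ c - 1)) * hU
  have e2 : PowerSeries.C u⁻¹ * ((PowerSeries.X : PowerSeries K) ^ d - PowerSeries.X ^ (c + d)) *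
      PowerSeries.X ^ b * PowerSeries.C u =
      PowerSeries.X ^ (b + d) - PowerSeries.X ^ (b + c + d) := by
    linear_combination ((PowerSeries.X ^ d - PowerSeries.X ^ (c + d)) * PowerSeries.X ^ b) * hU
  have e3 : (PowerSeries.X : PowerSeries K) ^ (b + c + d) *
      (PowerSeries.C u⁻¹ * (PowerSeries.X ^ c - 1)) +
      PowerSeries.C u⁻¹ * (PowerSeries.X ^ d - PowerSeries.X ^ (c + d)) * PowerSeries.X ^ b +
      PowerSeries.C u⁻¹ * (PowerSeries.X ^ d - PowerSeries.X ^ (c + d)) * PowerSeries.X ^ b *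
        PowerSeries.C u * (PowerSeries.C u⁻¹ * (PowerSeries.X ^ c - 1)) = 0 := by
    rw [e2]
    ring
  rw [e1, e3, e2, Matrix.single_zero, add_zero, Matrix.smul_single,
    PowerSeries.smul_eq_C_mul, mul_comm (PowerSeries.C u)]
  abel

theorem unitEquivalent_raise (hrs : r ≤ s) (f : Fin r → ℕ∞) (i : Fin r) {w : PowerSeries K}
    (hw : IsUnit w) :
    (diagArc K s f).UnitEquivalent (diagArc K s f +
      Matrix.single i (diagCol hrs i) ((w - 1) * tPowOver K (f i))) := by
  have hP : IsUnit (Matrix.diagonal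
      (Function.update (fun _ : Fin r => (1 : PowerSeries K)) i w)) := by
    rw [Matrix.isUnit_iff_isUnit_det, Matrix.det_diagonal, Finset.prod_update_of_mem (by simp)]
    simpa using hw
  have key := Matrix.UnitEquivalent.of_isUnit hP isUnit_one (diagArc K s f)
  convert key using 1
  ext1 k l
  rw [Matrix.mul_one, Matrix.diagonal_mul, Matrix.add_apply, diagArc_apply hrs,
    Matrix.single_apply]
  by_cases hk : i = k
  · subst hk
    by_cases hl : l = diagCol hrs i
    · simp [hl]; ring
    · simp [hl, Ne.symm hl]
  · simp [hk, Function.update_of_ne (Ne.symm hk)]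

theorem DegenerationStep.subset_closure (hrs : r ≤ s) [Algebra ℂ K] {f g : Fin r → ℕ∞}
    (h : DegenerationStep f g) :
    arcPoint '' matrixOrbit (diagArc K s g) ⊆
      closure (arcPoint '' matrixOrbit (diagArc K s f)) := by
  cases h with
  | raise i a h =>
    obtain ⟨w, hw⟩ := tPowOver_dvd_tPowOver (K := K).2 h
    -- On this line the entry is `t^a + u t^(f i) = (w + u) t^(f i)`, and `w + u` is a unit unless
    -- `u = -w(0)`. This includes `a = ∞`.
    refine matrixOrbit_subset_closure_of_line
      (B := Matrix.single i (diagCol hrs i) (tPowOver K (f i)))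
      (Set.finite_singleton (-PowerSeries.constantCoeff w)) fun u hu => ?_
    have hunit : IsUnit (w + PowerSeries.C u) := by
      rw [PowerSeries.isUnit_iff_constantCoeff, isUnit_iff_ne_zero, map_add,
        PowerSeries.constantCoeff_C]
      intro h0
      exact hu (by rw [Set.mem_singleton_iff]; linear_combination h0)
    convert unitEquivalent_raise hrs f i hunit using 1
    rw [diagArc_update hrs, hw, add_assoc, Matrix.smul_single, ← Matrix.single_add,
      PowerSeries.smul_eq_C_mul]
    congr 2
    ring
  | shift i j b c d hij hi hj =>
    exact matrixOrbit_subset_closure_of_line (Set.finite_singleton 0) fun u hu =>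
      unitEquivalent_shift hrs hij hi hj hu

theorem matrixOrbit_subset_closure (hrs : r ≤ s) [Algebra ℂ K] {f g : Fin r → ℕ∞}
    (h : Relation.ReflTransGen DegenerationStep f g) :
    arcPoint '' matrixOrbit (diagArc K s g) ⊆
      closure (arcPoint '' matrixOrbit (diagArc K s f)) := by
  induction h with
  | refl => exact _root_.subset_closure
  | tail _ h ih => exact subset_closure_trans (h.subset_closure hrs) ih

end Moves

/-! ### The orbits -/

section Orbits

variable {r s : ℕ}

theorem matrixOrbit_eq_of_unitEquivalent {K : Type*} [Field K]
    {M N : Matrix (Fin r) (Fin s) (PowerSeries K)} (h : M.UnitEquivalent N) :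
    matrixOrbit M = matrixOrbit N := by
  ext L
  rw [mem_matrixOrbit, mem_matrixOrbit]
  exact ⟨h.symm.trans, h.trans⟩

/-- A complex point has only one lift to a `K`-valued arc, so the first arc in the definition of the
orbit must be the diagonal one. -/
theorem mem_schemeOrbit_delta (lam : PrePartition r) (q : ArcSpace r s) :
    q ∈ schemeOrbit (arcPoint (deltaMatrix s lam)) ↔
      ∃ (K : Type) (_ : Field K) (_ : Algebra ℂ K),
        q ∈ arcPoint '' matrixOrbit (diagArc K s lam.terms) := by
  constructor
  · rintro ⟨K, _, _, M, N, hN, hM, rfl⟩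
    refine ⟨K, inferInstance, inferInstance, N, ?_, rfl⟩
    rw [eq_map_of_arcPoint_eq hM, deltaMatrix_eq_diagArc, diagArc_map] at hN
    exact hN
  · rintro ⟨K, _, _, N, hN, rfl⟩
    exact ⟨K, inferInstance, inferInstance, _, N, hN, arcPoint_diagArc _, rfl⟩

theorem closedOrbit_subset_schemeOrbit (lam : PrePartition r) :
    closedOrbit (deltaMatrix s lam) ⊆ schemeOrbit (arcPoint (deltaMatrix s lam)) := fun q hq =>
  (mem_schemeOrbit_delta lam q).2 ⟨ℂ, inferInstance, inferInstance, hq⟩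

/-- Upper semicontinuity of the orders of the minors. -/
theorem le_of_arcPoint_mem_closure (hrs : r ≤ s) {K : Type*} [Field K] [Algebra ℂ K]
    {lam mu : PrePartition r} {N : Matrix (Fin r) (Fin s) (PowerSeries K)}
    (hN : (diagArc K s mu.terms).UnitEquivalent N)
    (hcl : arcPoint N ∈ closure (schemeOrbit (arcPoint (deltaMatrix s lam)))) : lam ≤ mu := by
  intro i
  refine sum_le_of_dvdMinors_diagArc (K := K) hrs
    (Matrix.DvdMinors.of_unitEquivalent (dvdMinors_of_mem_closure ?_ hcl) hN.symm)
  intro p hp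
  obtain ⟨L, _, _, M, hM, rfl⟩ := (mem_schemeOrbit_delta lam p).1 hp
  exact ⟨L, inferInstance, inferInstance, M, rfl,
    (dvdMinors_diagArc lam.anti i).of_unitEquivalent (mem_matrixOrbit.1 hM)⟩

theorem closedOrbit_subset_closure_iff (hrs : r ≤ s) (lam mu : PrePartition r) :
    closedOrbit (deltaMatrix s mu) ⊆ closure (closedOrbit (deltaMatrix s lam)) ↔ lam ≤ mu := by
  refine ⟨fun h => ?_, fun h => matrixOrbit_subset_closure hrs (degeneration_of_le h)⟩
  refine le_of_arcPoint_mem_closure hrs (.refl _)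
    (closure_mono (closedOrbit_subset_schemeOrbit lam) (h ⟨_, ?_, rfl⟩))
  exact mem_matrixOrbit.2 (.refl _)

theorem schemeOrbit_subset_closure_iff (hrs : r ≤ s) (lam mu : PrePartition r) :
    schemeOrbit (arcPoint (deltaMatrix s mu)) ⊆
      closure (schemeOrbit (arcPoint (deltaMatrix s lam))) ↔ lam ≤ mu := by
  constructor
  · intro h
    refine le_of_arcPoint_mem_closure hrs (.refl (diagArc ℂ s mu.terms))
      (h (closedOrbit_subset_schemeOrbit mu ?_))
    exact ⟨_, mem_matrixOrbit.2 (.refl _), rfl⟩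
  · intro h q hq
    obtain ⟨K, _, _, hq⟩ := (mem_schemeOrbit_delta mu q).1 hq
    exact closure_mono (fun p hp =>
      (mem_schemeOrbit_delta lam p).2 ⟨K, inferInstance, inferInstance, hp⟩)
      (matrixOrbit_subset_closure hrs (degeneration_of_le h) hq)

/-- The exponents of an arc depend only on the underlying point. -/
theorem eq_of_arcPoint_eq (hrs : r ≤ s) {K L : Type} [Field K] [Field L] [Algebra ℂ K]
    [Algebra ℂ L] {lam mu : PrePartition r} {M : Matrix (Fin r) (Fin s) (PowerSeries K)}
    {N : Matrix (Fin r) (Fin s) (PowerSeries L)} (h : arcPoint M = arcPoint N)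
    (hM : (diagArc K s lam.terms).UnitEquivalent M)
    (hN : (diagArc L s mu.terms).UnitEquivalent N) : lam = mu := by
  refine le_antisymm (le_of_arcPoint_mem_closure hrs hN (subset_closure ?_))
    (le_of_arcPoint_mem_closure hrs hM (subset_closure ?_))
  · rw [mem_schemeOrbit_delta]
    exact ⟨K, inferInstance, inferInstance, M, mem_matrixOrbit.2 hM, h⟩
  · rw [mem_schemeOrbit_delta]
    exact ⟨L, inferInstance, inferInstance, N, mem_matrixOrbit.2 hN, h.symm⟩

/-- The arcs at a point have the same exponents over all fields, and a common extension of two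
fields makes arcs with equal exponents conjugate. -/
theorem exists_schemeOrbit_eq (hrs : r ≤ s) (p : ArcSpace r s) :
    ∃ lam : PrePartition r, schemeOrbit p = schemeOrbit (arcPoint (deltaMatrix s lam)) := by
  obtain ⟨K, _, _, M, rfl⟩ := exists_arcPoint_eq p
  obtain ⟨lam, hM⟩ := exists_unitEquivalent_diagArc hrs M
  refine ⟨lam, ?_⟩
  ext q
  rw [mem_schemeOrbit_delta]
  constructor
  · rintro ⟨L, _, _, M', N, hN, hM', rfl⟩
    obtain ⟨mu, hmu⟩ := exists_unitEquivalent_diagArc hrs M'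
    obtain rfl := eq_of_arcPoint_eq hrs hM' hmu hM
    exact ⟨L, inferInstance, inferInstance, N,
      mem_matrixOrbit.2 (hmu.trans (mem_matrixOrbit.1 hN)), rfl⟩
  · rintro ⟨L, _, _, N, hN, rfl⟩
    obtain ⟨F, _, _, ⟨φ⟩, ⟨ψ⟩⟩ := exists_common_extension K L
    refine ⟨F, inferInstance, inferInstance, _, _, ?_, arcPoint_map φ M, arcPoint_map ψ N⟩
    have h₁ := hM.map (PowerSeries.map (φ : K →+* F))
    have h₂ := (mem_matrixOrbit.1 hN).map (PowerSeries.map (ψ : L →+* F))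
    rw [diagArc_map] at h₁ h₂
    exact mem_matrixOrbit.2 (h₁.symm.trans h₂)

theorem closedOrbitOf_surjective (hrs : r ≤ s) :
    Function.Surjective (closedOrbitOf (r := r) s) := by
  rintro ⟨C, M, rfl⟩
  obtain ⟨lam, hM⟩ := exists_unitEquivalent_diagArc hrs M
  refine ⟨lam, ClosedArcOrbit.ext ?_⟩
  change closedOrbit (diagArc ℂ s lam.terms) = closedOrbit M
  rw [closedOrbit, closedOrbit, matrixOrbit_eq_of_unitEquivalent hM]

theorem schemeOrbitOf_surjective (hrs : r ≤ s) :
    Function.Surjective (schemeOrbitOf (r := r) s) := by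
  rintro ⟨C, p, rfl⟩
  obtain ⟨lam, h⟩ := exists_schemeOrbit_eq hrs p
  exact ⟨lam, SchemeArcOrbit.ext h.symm⟩

end Orbits

/-- A surjection from a partial order onto a preorder that reverses the order relations is an
anti-isomorphism, and the preorder is a partial order. -/
theorem exists_orderIso_dual {α β : Type*} [PartialOrder α] [Preorder β] {F : α → β}
    (hsurj : Function.Surjective F) (hF : ∀ a b, F b ≤ F a ↔ a ≤ b) :
    (∃ e : α ≃o βᵒᵈ, ∀ a, e a = OrderDual.toDual (F a)) ∧
      ∀ C D : β, C ≤ D → D ≤ C → C = D := by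
  have hinj : Function.Injective F := fun a b h =>
    le_antisymm ((hF a b).1 h.ge) ((hF b a).1 h.le)
  refine ⟨⟨⟨(Equiv.ofBijective F ⟨hinj, hsurj⟩).trans OrderDual.toDual, ?_⟩, fun _ => rfl⟩, ?_⟩
  · intro a b
    exact hF a b
  · intro C D hCD hDC
    obtain ⟨a, rfl⟩ := hsurj C
    obtain ⟨b, rfl⟩ := hsurj D
    rw [le_antisymm ((hF a b).1 hDC) ((hF b a).1 hCD)]

theorem PrePartition.le_iff_rev {r : ℕ} {lam mu : PrePartition r} :
    lam ≤ mu ↔ ∀ i : Fin r, ∑ j ∈ Finset.Ici i.rev, lam.terms j ≤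
      ∑ j ∈ Finset.Ici i.rev, mu.terms j :=
  ⟨fun h i => h i.rev, fun h i => by simpa using h i.rev⟩

theorem mainTheorem2 (r s : ℕ) (hrs : r ≤ s) :
    -- orbits as sets of closed points
    ((∃ e : PrePartition r ≃o (ClosedArcOrbit r s)ᵒᵈ,
        ∀ lam : PrePartition r, e lam = OrderDual.toDual (closedOrbitOf s lam)) ∧
      (∀ C D : ClosedArcOrbit r s, C ≤ D → D ≤ C → C = D) ∧
      ∀ lam mu : PrePartition r,
        ((closedOrbitOf s mu).carrier ⊆ closure (closedOrbitOf s lam).carrier ↔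
          ∀ i : Fin r, ∑ j ∈ Finset.Ici i.rev, lam.terms j ≤
            ∑ j ∈ Finset.Ici i.rev, mu.terms j)) ∧
    -- orbits as sets of points of the scheme, closed or not
    ((∃ e : PrePartition r ≃o (SchemeArcOrbit r s)ᵒᵈ,
        ∀ lam : PrePartition r, e lam = OrderDual.toDual (schemeOrbitOf s lam)) ∧
      (∀ C D : SchemeArcOrbit r s, C ≤ D → D ≤ C → C = D) ∧
      ∀ lam mu : PrePartition r,
        ((schemeOrbitOf s mu).carrier ⊆ closure (schemeOrbitOf s lam).carrier ↔
          ∀ i : Fin r, ∑ j ∈ Finset.Ici i.rev, lam.terms j ≤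
            ∑ j ∈ Finset.Ici i.rev, mu.terms j)) := by
  have h₁ := exists_orderIso_dual (closedOrbitOf_surjective hrs)
    (closedOrbit_subset_closure_iff hrs)
  have h₂ := exists_orderIso_dual (schemeOrbitOf_surjective hrs)
    (schemeOrbit_subset_closure_iff hrs)
  exact ⟨⟨h₁.1, h₁.2, fun lam mu =>
      (closedOrbit_subset_closure_iff hrs lam mu).trans PrePartition.le_iff_rev⟩,
    ⟨h₂.1, h₂.2, fun lam mu =>
      (schemeOrbit_subset_closure_iff hrs lam mu).trans PrePartition.le_iff_rev⟩⟩
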